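/- Let $n,m\ge 0$, and let $P\subseteq\mathbb R^n$ and $Q\subseteq\mathbb R^m$ be closed convex cones that contain $0$, contain no line, and have nonempty interior. Order $\mathbb R^n$ and $\mathbb R^m$ by $x\le x'\Leftrightarrow x'-x\in P$ and $u\le u'\Leftrightarrow u'-u\in Q$. A real matrix is called monotone if the linear map it defines preserves these orders; a square matrix is Hurwitz if all its complex eigenvalues have negative real part. Consider the linear system $\dot x=Ax+Bu$ with output $h(x)=-Cx$, where $A\in\mathbb R^{n\times n}$ is quasi-monotone (that is, $e^{tA}$ is monotone for all $t>0$) and Hurwitz, and $B\in\mathbb R^{n\times m}$ and $C\in\mathbb R^{m\times n}$ are monotone. Put $$F=\begin{pmatrix}A&0\\-BC&A\end{pmatrix},\qquad G=\begin{pmatrix}B\\0\end{pmatrix},\qquad H=\begin{pmatrix}0&-C\end{pmatrix},\qquad K=-CA^{-1}B,$$ so that $F+GH=\begin{pmatrix}A&-BC\\-BC&A\end{pmatrix}$ is the matrix of the closed-loop extended system $\dot x=Ax+Bh(z)$, $\dot z=Az+Bh(x)$. Let $k(u)=h(-A^{-1}Bu)$ be the steady-state output of $\dot x=Ax+Bu$,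 $y=h(x)$ under the constant input $u$. Then the following are equivalent: 1. $F+GH$ is Hurwitz; 2. the spectral radius satisfies $\rho(K)<1$; 3. all eigenvalues of $K^2$ lie strictly inside the unit disk; 4. the iteration $u^+=k(u)$ on $\mathbb R^m$ is globally convergent, i.e. there is $\bar u\in\mathbb R^m$ such that $k^j(u)\to\bar u$ as $j\to\infty$ for every $u\in\mathbb R^m$; 5. $A-BC$ and $A+BC$ are both Hurwitz; 6. $A+BC$ is Hurwitz. -/

import Mathlib

open Matrix Filter Topology

namespace ExtendedSystem

/-- A cone inducing the order on `ℝⁿ`. A `ProperCone` of Mathlib is a closed convex cone that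
contains `0`; we also ask that it contain no line (so that the induced relation is a partial
order) and have nonempty interior. -/
structure IsOrderCone {n : ℕ} (P : ProperCone ℝ (Fin n → ℝ)) : Prop where
  salient : ∀ x ∈ P, -x ∈ P → x = 0
  solid : (interior (P : Set (Fin n → ℝ))).Nonempty

/-- The order induced by a cone: `x ≤ y` iff `y - x` lies in the cone. -/
def ConeLE {n : ℕ} (P : ProperCone ℝ (Fin n → ℝ)) (x y : Fin n → ℝ) : Prop :=
  y - x ∈ P

/-- A matrix is monotone if the linear map it defines preserves the orders given by `P`, `Q`. -/
def IsMonotone {n m : ℕ} (P : ProperCone ℝ (Fin n → ℝ)) (Q : ProperCone ℝ (Fin m → ℝ))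
    (M : Matrix (Fin m) (Fin n) ℝ) : Prop :=
  ∀ x y, ConeLE P x y → ConeLE Q (M *ᵥ x) (M *ᵥ y)

/-- A square matrix `A` is quasi-monotone if all exponentials `e^{tA}`, `t > 0`, are monotone. -/
def IsQuasiMonotone {n : ℕ} (P : ProperCone ℝ (Fin n → ℝ))
    (A : Matrix (Fin n) (Fin n) ℝ) : Prop :=
  ∀ t : ℝ, 0 < t → IsMonotone P P (NormedSpace.exp (t • A))

section General

variable {ι : Type*} [Fintype ι] [DecidableEq ι]

/-- The set of complex eigenvalues of a real square matrix. -/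
def eigenvalues (M : Matrix ι ι ℝ) : Set ℂ :=
  spectrum ℂ (M.map Complex.ofReal)

/-- A real square matrix is Hurwitz if all its complex eigenvalues have negative real part. -/
def IsHurwitz (M : Matrix ι ι ℝ) : Prop :=
  ∀ μ ∈ eigenvalues M, μ.re < 0

/-- The spectral radius of a real square matrix: the largest modulus of a complex eigenvalue. -/
noncomputable def specRadius (M : Matrix ι ι ℝ) : ENNReal :=
  spectralRadius ℂ (M.map Complex.ofReal)

end General

section System

variable {n m : ℕ} (A : Matrix (Fin n) (Fin n) ℝ) (B : Matrix (Fin n) (Fin m) ℝ)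
  (C : Matrix (Fin m) (Fin n) ℝ)

/-- State matrix of the extended system `ẋ = Ax + Bu`, `ż = Az - BCx`. -/
def extF : Matrix (Fin n ⊕ Fin n) (Fin n ⊕ Fin n) ℝ :=
  fromBlocks A 0 (-(B * C)) A

/-- Input matrix of the extended system. -/
def extG : Matrix (Fin n ⊕ Fin n) (Fin m) ℝ :=
  fromRows B 0

/-- Output matrix of the extended system, with output `y = -Cz`. -/
def extH : Matrix (Fin m) (Fin n ⊕ Fin n) ℝ :=
  fromCols 0 (-C)

/-- The gain matrix `K = -C A⁻¹ B`. -/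
noncomputable def gain : Matrix (Fin m) (Fin m) ℝ :=
  -(C * A⁻¹ * B)

/-- The characteristic of `ẋ = Ax + Bu`, `y = -Cx`: it sends a constant input `u` to the output
`-C x_u` at the steady state `x_u = -A⁻¹ B u`. Note that it equals `u ↦ -(K u)`. -/
noncomputable def characteristic (u : Fin m → ℝ) : Fin m → ℝ :=
  -(C *ᵥ (-(A⁻¹ *ᵥ (B *ᵥ u))))

end System

end ExtendedSystem

/-! Interior points of the cones serve as certificates, in place of Perron–Frobenius eigenvectors.
Put M = A + BC; note K = C(-A)⁻¹B is monotone, because -A has a positive inverse. The link between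
input and state space is that some w ∈ int Q has w - Kw ∈ int Q iff some v ∈ int P has -Mv ∈ int P
(`exists_interior_state`, `exists_interior_input`).

From certificate to spectrum: an interior point is an order unit, and order bounds are norm bounds
for a salient cone, so a matrix shrinking an order interval has small eigenvalues
(`norm_eigenvalue_le_of_order_unit`). Applied to K this gives ρ(K) < 1; applied to resolvents at
large r it gives A ± BC Hurwitz.

Back to certificates: if Kᵏ → 0, respectively if M is Hurwitz, then 1 - K, respectively -M, has a
positive inverse, which sends interior points to interior points. The closed loop splits into A - BC
and A + BC on the vectors (x, x) and (x, -x). -/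

namespace ExtendedSystem

/-! ### Order cones and their interiors -/

section Cone

variable {n m : ℕ} {P : ProperCone ℝ (Fin n → ℝ)} {Q : ProperCone ℝ (Fin m → ℝ)}

lemma isMonotone_iff {M : Matrix (Fin m) (Fin n) ℝ} :
    IsMonotone P Q M ↔ ∀ x ∈ P, M *ᵥ x ∈ Q := by
  refine ⟨fun h x hx => ?_, fun h x y hxy => ?_⟩
  · simpa [ConeLE] using h 0 x (by simpa [ConeLE] using hx)
  · simpa [ConeLE, Matrix.mulVec_sub] using h _ hxy

lemma interior_add_mem {x y : Fin n → ℝ} (hx : x ∈ interior (P : Set (Fin n → ℝ)))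
    (hy : y ∈ P) : x + y ∈ interior (P : Set (Fin n → ℝ)) := by
  have ho : IsOpen ((fun z => z - y) ⁻¹' interior (P : Set (Fin n → ℝ))) :=
    isOpen_interior.preimage (by fun_prop)
  refine mem_interior.2 ⟨_, fun z hz => ?_, ho, by simpa using hx⟩
  have := P.add_mem (interior_subset hz : z - y ∈ P) hy
  simpa using this

lemma smul_mem_interior {x : Fin n → ℝ} {c : ℝ} (hc : 0 < c)
    (hx : x ∈ interior (P : Set (Fin n → ℝ))) : c • x ∈ interior (P : Set (Fin n → ℝ)) := by
  have ho : IsOpen ((fun z => c⁻¹ • z) ⁻¹' interior (P : Set (Fin n → ℝ))) :=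
    isOpen_interior.preimage (by fun_prop)
  refine mem_interior.2 ⟨_, fun z hz => ?_, ho, by simpa [smul_smul, hc.ne'] using hx⟩
  have := P.smul_mem (interior_subset hz : c⁻¹ • z ∈ P) hc.le
  simpa [smul_smul, hc.ne'] using this

lemma eventually_sub_smul_mem {p : Fin n → ℝ} (hp : p ∈ interior (P : Set (Fin n → ℝ)))
    (v : Fin n → ℝ) : ∀ᶠ ε : ℝ in 𝓝[>] 0, p - ε • v ∈ P := by
  have hc : Tendsto (fun ε : ℝ => p - ε • v) (𝓝[>] 0) (𝓝 p) := by
    have : Continuous (fun ε : ℝ => p - ε • v) := by fun_prop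
    simpa using (this.tendsto 0).mono_left nhdsWithin_le_nhds
  exact (hc.eventually (isOpen_interior.mem_nhds hp)).mono fun _ h => interior_subset h

/-- Normality of a salient cone in finite dimension. The sum of the distances of y and -y to the
cone is positive on the unit sphere, hence at least some c > 0 by compactness, whereas the order
bounds place both ±y/‖y‖ within t‖v‖/‖y‖ of the cone. -/
lemma exists_order_norm_bound (hP : IsOrderCone P) (v : Fin n → ℝ) :
    ∃ R : ℝ, ∀ t : ℝ, 0 ≤ t → ∀ y, t • v + y ∈ P → t • v - y ∈ P → ‖y‖ ≤ R * t := by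
  have hne : (P : Set (Fin n → ℝ)).Nonempty := ⟨0, P.zero_mem⟩
  let f : (Fin n → ℝ) → ℝ := fun y =>
    Metric.infDist y (P : Set (Fin n → ℝ)) + Metric.infDist (-y) (P : Set (Fin n → ℝ))
  have hf : Continuous f := by
    have := Metric.continuous_infDist_pt (P : Set (Fin n → ℝ))
    fun_prop
  obtain ⟨c, hc, hcf⟩ := (isCompact_sphere (0 : Fin n → ℝ) 1).exists_forall_le'
    (f := f) (a := 0) hf.continuousOn (fun y hy => by
      by_contra hle
      have h1 := Metric.infDist_nonneg (x := y) (s := (P : Set (Fin n → ℝ)))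
      have h2 := Metric.infDist_nonneg (x := -y) (s := (P : Set (Fin n → ℝ)))
      have h3 : f y ≤ 0 := not_lt.1 hle
      have h4 : y ∈ P := (P.isClosed.mem_iff_infDist_zero hne).2 (by simp only [f] at h3; linarith)
      have h5 : -y ∈ P := (P.isClosed.mem_iff_infDist_zero hne).2 (by simp only [f] at h3; linarith)
      have h6 := hP.salient y h4 h5
      simp [h6] at hy)
  refine ⟨2 * ‖v‖ / c, fun t ht y h1 h2 => ?_⟩
  rcases eq_or_ne y 0 with rfl | hy
  · simp only [norm_zero]; positivity
  have hy' : 0 < ‖y‖ := norm_pos_iff.2 hy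
  have key : ∀ z, ‖z‖ = ‖y‖ → t • v + z ∈ P →
      Metric.infDist (‖y‖⁻¹ • z) (P : Set (Fin n → ℝ)) ≤ ‖y‖⁻¹ * (t * ‖v‖) := by
    intro z hz h
    refine (Metric.infDist_le_dist_of_mem
      (P.smul_mem h (inv_nonneg.2 hy'.le) : ‖y‖⁻¹ • (t • v + z) ∈ P)).trans ?_
    rw [dist_eq_norm, ← smul_sub, sub_add_cancel_right, norm_smul, norm_neg, norm_smul]
    simp [abs_of_nonneg ht]
  have h3 := hcf (‖y‖⁻¹ • y) (by simp [norm_smul, hy'.ne'])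
  have h4 := key y rfl h1
  have h5 := key (-y) (norm_neg y) (by simpa [sub_eq_add_neg] using h2)
  rw [smul_neg] at h5
  have h6 : c ≤ ‖y‖⁻¹ * (2 * (t * ‖v‖)) := by simp only [f] at h3; linarith
  rw [le_inv_mul_iff₀ hy'] at h6
  rw [div_mul_eq_mul_div, le_div_iff₀ hc]
  linarith

end Cone

/-! ### Complex eigenvalues of real matrices -/

section Eigen

variable {ι : Type*} [Fintype ι]

lemma map_mulVec_apply (M : Matrix ι ι ℝ) (z : ι → ℂ) (i : ι) :
    (M.map Complex.ofReal *ᵥ z) i =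
      ((M *ᵥ fun j => (z j).re) i : ℂ) + ((M *ᵥ fun j => (z j).im) i : ℂ) * Complex.I := by
  simp only [Matrix.mulVec, dotProduct, Matrix.map_apply]
  push_cast
  rw [Finset.sum_mul, ← Finset.sum_add_distrib]
  refine Finset.sum_congr rfl fun j _ => ?_
  conv_lhs => rw [← Complex.re_add_im (z j)]
  ring

variable [DecidableEq ι]

lemma mem_eigenvalues_iff {M : Matrix ι ι ℝ} {μ : ℂ} :
    μ ∈ eigenvalues M ↔ ∃ z : ι → ℂ, z ≠ 0 ∧ M.map Complex.ofReal *ᵥ z = μ • z := by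
  rw [eigenvalues, spectrum.mem_iff, Matrix.isUnit_iff_isUnit_det, isUnit_iff_ne_zero, not_not,
    ← Matrix.exists_mulVec_eq_zero_iff]
  refine exists_congr fun z => and_congr_right fun _ => ?_
  rw [Matrix.sub_mulVec, sub_eq_zero, Algebra.algebraMap_eq_smul_one, Matrix.smul_mulVec,
    Matrix.one_mulVec, eq_comm]

lemma pow_mulVec_eigenvector {M : Matrix ι ι ℝ} {μ : ℂ} {z : ι → ℂ}
    (h : M.map Complex.ofReal *ᵥ z = μ • z) (k : ℕ) :
    (M ^ k).map Complex.ofReal *ᵥ z = μ ^ k • z := by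
  have hk : (M ^ k).map Complex.ofReal = M.map Complex.ofReal ^ k :=
    map_pow (Complex.ofRealHom.mapMatrix (m := ι)) M k
  rw [hk]
  clear hk
  induction k with
  | zero => simp
  | succ k ih => rw [pow_succ', ← Matrix.mulVec_mulVec, ih, Matrix.mulVec_smul, h, smul_smul,
      pow_succ]

/-- Real orbit bounds applied to the real and imaginary parts of an eigenvector z give ‖μ‖ᵏ‖zᵢ‖ ≤
const · cᵏ, which fails for large k if ‖μ‖ > c. -/
lemma norm_eigenvalue_le {M : Matrix ι ι ℝ} {c : ℝ} (hc : 0 ≤ c)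
    (hM : ∀ x, ∃ R : ℝ, ∀ k : ℕ, ‖(M ^ k) *ᵥ x‖ ≤ R * c ^ k) {μ : ℂ} (hμ : μ ∈ eigenvalues M) :
    ‖μ‖ ≤ c := by
  obtain ⟨z, hz, h⟩ := mem_eigenvalues_iff.1 hμ
  obtain ⟨i, hi⟩ := Function.ne_iff.1 hz
  obtain ⟨R₁, h₁⟩ := hM fun j => (z j).re
  obtain ⟨R₂, h₂⟩ := hM fun j => (z j).im
  have hi' : 0 < ‖z i‖ := norm_pos_iff.2 hi
  have hb : ∀ k : ℕ, ‖μ‖ ^ k * ‖z i‖ ≤ (R₁ + R₂) * c ^ k := by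
    intro k
    have e := map_mulVec_apply (M ^ k) z i
    rw [pow_mulVec_eigenvector h, Pi.smul_apply, smul_eq_mul] at e
    have : ‖μ ^ k * z i‖ ≤ R₁ * c ^ k + R₂ * c ^ k := by
      rw [e]
      refine (norm_add_le _ _).trans (add_le_add ?_ ?_)
      · rw [Complex.norm_real]; exact (norm_le_pi_norm _ i).trans (h₁ k)
      · rw [norm_mul, Complex.norm_I, mul_one, Complex.norm_real]
        exact (norm_le_pi_norm _ i).trans (h₂ k)
    rw [norm_mul, norm_pow] at this
    linarith
  by_contra! hlt
  have hμ0 : 0 < ‖μ‖ := hc.trans_lt hlt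
  have hr : Tendsto (fun k : ℕ => (R₁ + R₂) * (c / ‖μ‖) ^ k) atTop (𝓝 ((R₁ + R₂) * 0)) :=
    (tendsto_pow_atTop_nhds_zero_of_lt_one (by positivity) ((div_lt_one hμ0).2 hlt)).const_mul _
  rw [mul_zero] at hr
  refine absurd (ge_of_tendsto' hr fun k => ?_) (not_le.2 hi')
  rw [div_pow, ← mul_div_assoc, le_div_iff₀ (by positivity)]
  linarith [hb k]

end Eigen

/-! ### Eigenvalue bounds from an order unit -/

section OrderUnit

variable {n : ℕ} {P : ProperCone ℝ (Fin n → ℝ)}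

/-- If `T` maps the order interval `[-v, v]` of an interior point `v` of the cone into
`[-cv, cv]`, then the eigenvalues of `T` have modulus at most `c`. -/
lemma norm_eigenvalue_le_of_order_unit (hP : IsOrderCone P) {v : Fin n → ℝ}
    (hv : v ∈ interior (P : Set (Fin n → ℝ))) {T : Matrix (Fin n) (Fin n) ℝ} {c : ℝ} (hc : 0 ≤ c)
    (hT : ∀ x, v + x ∈ P → v - x ∈ P → c • v + T *ᵥ x ∈ P ∧ c • v - T *ᵥ x ∈ P)
    {μ : ℂ} (hμ : μ ∈ eigenvalues T) : ‖μ‖ ≤ c := by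
  refine norm_eigenvalue_le hc (fun x => ?_) hμ
  obtain ⟨R, hR⟩ := exists_order_norm_bound hP v
  obtain ⟨ε, ⟨h₁, h₂⟩, hε⟩ := ((eventually_sub_smul_mem hv x).and
    (eventually_sub_smul_mem hv (-x))).and self_mem_nhdsWithin |>.exists
  have hε : 0 < ε := hε
  have step : ∀ k : ℕ, c ^ k • v + ε • (T ^ k *ᵥ x) ∈ P ∧ c ^ k • v - ε • (T ^ k *ᵥ x) ∈ P := by
    intro k
    induction k with
    | zero => exact ⟨by simpa using h₂, by simpa using h₁⟩
    | succ k ih =>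
      -- Rescaling by c⁻ᵏ needs c > 0. If c = 0, the bound with t = 0 already forces Tᵏx = 0 for k ≥
      -- 1.
      rcases hc.eq_or_lt with rfl | hc'
      · rcases Nat.eq_zero_or_pos k with rfl | hk
        · have := hT (ε • x) (by simpa using ih.1) (by simpa using ih.2)
          simpa [Matrix.mulVec_smul] using this
        · have h0 := hR 0 le_rfl (ε • (T ^ k *ᵥ x)) (by simpa [hk.ne'] using ih.1)
            (by simpa [hk.ne'] using ih.2)
          have h0' : T ^ k *ᵥ x = 0 := by
            simpa [hε.ne'] using h0
          rw [pow_succ', pow_succ', ← Matrix.mulVec_mulVec, h0']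
          simp
      · have hck : 0 < c ^ k := pow_pos hc' k
        have a : ∀ w, c ^ k • v + w ∈ P → v + (c ^ k)⁻¹ • w ∈ P := fun w hw => by
          simpa [smul_smul, hck.ne'] using P.smul_mem hw (inv_nonneg.2 hck.le)
        have b : ∀ w, c • v + T *ᵥ ((c ^ k)⁻¹ • w) ∈ P → c ^ (k + 1) • v + T *ᵥ w ∈ P :=
          fun w hw => by
            have := P.smul_mem hw hck.le
            rw [smul_add, Matrix.mulVec_smul, smul_smul, smul_smul, mul_inv_cancel₀ hck.ne',
              one_smul, ← pow_succ] at this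
            exact this
        have h₃ := hT ((c ^ k)⁻¹ • ε • (T ^ k *ᵥ x)) (a _ ih.1) (by
          have := a (-(ε • (T ^ k *ᵥ x))) (by simpa [sub_eq_add_neg] using ih.2)
          simpa [sub_eq_add_neg] using this)
        have e : T *ᵥ (ε • (T ^ k *ᵥ x)) = ε • (T ^ (k + 1) *ᵥ x) := by
          rw [Matrix.mulVec_smul, Matrix.mulVec_mulVec, pow_succ']
        refine ⟨e ▸ b _ h₃.1, ?_⟩
        have := b (-(ε • (T ^ k *ᵥ x))) (by
          simpa [Matrix.mulVec_neg, sub_eq_add_neg] using h₃.2)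
        rw [Matrix.mulVec_neg, e] at this
        simpa [sub_eq_add_neg] using this
  refine ⟨ε⁻¹ * R, fun k => ?_⟩
  have := hR (c ^ k) (pow_nonneg hc k) _ (step k).1 (step k).2
  rw [norm_smul, Real.norm_of_nonneg hε.le] at this
  rw [mul_assoc, le_inv_mul_iff₀ hε]
  exact this

end OrderUnit

/-! ### Convergence of powers, resolvents and exponentials -/

section Norms

attribute [local instance] Matrix.linftyOpNormedRing Matrix.linftyOpNormedAlgebra

variable {ι : Type*} [Fintype ι]

lemma tendsto_mulVec {κ : Type*} {l : Filter κ} {M : κ → Matrix ι ι ℝ} {N : Matrix ι ι ℝ}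
    (h : Tendsto M l (𝓝 N)) (x : ι → ℝ) : Tendsto (fun k => M k *ᵥ x) l (𝓝 (N *ᵥ x)) := by
  have : Continuous fun S : Matrix ι ι ℝ => S *ᵥ x := by fun_prop
  exact (this.tendsto N).comp h

variable [DecidableEq ι]

lemma norm_one_matrix_le : ‖(1 : Matrix ι ι ℝ)‖ ≤ 1 := by
  rcases isEmpty_or_nonempty ι with h | h
  · rw [Subsingleton.elim (1 : Matrix ι ι ℝ) 0, norm_zero]; exact zero_le_one
  · rw [norm_one]

lemma tendsto_pow_mulVec_of_norm_lt_one {S : Matrix ι ι ℝ} (h : ‖S‖ < 1) (x : ι → ℝ) :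
    Tendsto (fun k : ℕ => (S ^ k) *ᵥ x) atTop (𝓝 0) := by
  simpa using tendsto_mulVec (tendsto_pow_atTop_nhds_zero_of_norm_lt_one h) x

lemma specRadius_lt_one_iff {M : Matrix ι ι ℝ} :
    specRadius M < 1 ↔ ∀ μ ∈ eigenvalues M, ‖μ‖ < 1 := by
  constructor
  · intro h μ hμ
    have h1 : (‖μ‖₊ : ENNReal) ≤ specRadius M := le_iSup₂ (f := fun k _ => (‖k‖₊ : ENNReal)) μ hμ
    exact_mod_cast h1.trans_lt h
  · intro h
    rcases (eigenvalues M).eq_empty_or_nonempty with he | hne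
    · have : specRadius M = 0 := by
        rw [specRadius, spectralRadius]
        rw [eigenvalues] at he
        simp [he]
      simp [this]
    · exact spectrum.spectralRadius_lt_of_forall_lt_of_nonempty hne fun k hk => h k hk

/-- Gelfand's formula over ℂ gives ‖Sᵏ‖ ≤ rᵏ eventually, for some r < 1; taking real parts returns
to ℝ. -/
lemma tendsto_pow_mulVec_of_specRadius_lt_one {S : Matrix ι ι ℝ} (h : specRadius S < 1)
    (x : ι → ℝ) : Tendsto (fun k : ℕ => (S ^ k) *ᵥ x) atTop (𝓝 0) := by
  set M := S.map Complex.ofReal with hM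
  have hg := spectrum.pow_nnnorm_pow_one_div_tendsto_nhds_spectralRadius M
  obtain ⟨r, hr, hr1⟩ := ENNReal.lt_iff_exists_nnreal_btwn.1 h
  have hr1' : (r : ℝ) < 1 := by exact_mod_cast hr1
  have hb : ∀ᶠ k : ℕ in atTop, ‖M ^ k‖ ≤ (r : ℝ) ^ k := by
    filter_upwards [hg.eventually_lt_const hr, eventually_gt_atTop 0] with k hk hk0
    have hk' : (0 : ℝ) < k := by exact_mod_cast hk0
    have := ENNReal.rpow_le_rpow hk.le hk'.le
    rw [← ENNReal.rpow_mul, one_div, inv_mul_cancel₀ hk'.ne', ENNReal.rpow_one,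
      ENNReal.rpow_natCast] at this
    exact_mod_cast this
  have h0 : Tendsto (fun k : ℕ => M ^ k) atTop (𝓝 0) :=
    squeeze_zero_norm' hb (tendsto_pow_atTop_nhds_zero_of_lt_one r.2 hr1')
  have hre : Continuous fun N : Matrix ι ι ℂ => N.map Complex.re :=
    continuous_id.matrix_map Complex.continuous_re
  have h1 : Tendsto (fun k : ℕ => S ^ k) atTop (𝓝 0) := by
    have h2 := (hre.tendsto 0).comp h0
    have h3 : (0 : Matrix ι ι ℂ).map Complex.re = 0 := by ext; simp
    rw [h3] at h2
    refine h2.congr fun k => ?_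
    have hk : (S ^ k).map Complex.ofReal = M ^ k :=
      map_pow (Complex.ofRealHom.mapMatrix (m := ι)) S k
    simp only [Function.comp_apply, ← hk]
    ext; simp
  simpa using tendsto_mulVec h1 x

lemma eventually_isUnit_resolvent (A : Matrix ι ι ℝ) :
    ∀ᶠ r : ℝ in atTop, IsUnit (r • (1 : Matrix ι ι ℝ) - A).det := by
  filter_upwards [eventually_gt_atTop (‖A‖ * ‖(1 : Matrix ι ι ℝ)‖)] with r hr
  have := spectrum.mem_resolventSet_of_norm_lt_mul (k := r) (hr.trans_le (Real.le_norm_self r))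
  rwa [spectrum.mem_resolventSet_iff, Matrix.isUnit_iff_isUnit_det,
    Algebra.algebraMap_eq_smul_one] at this

lemma eventually_tendsto_resolvent_mul_pow (A D : Matrix ι ι ℝ) :
    ∀ᶠ r : ℝ in atTop, ∀ x, Tendsto
      (fun k : ℕ => (((r • (1 : Matrix ι ι ℝ) - A)⁻¹ * D) ^ k) *ᵥ x) atTop (𝓝 0) := by
  have h1 : Tendsto (fun r : ℝ => resolvent A r * D) atTop (𝓝 (0 * D)) :=
    ((spectrum.resolvent_tendsto_cobounded A).comp
      (tendsto_norm_atTop_iff_cobounded.1 tendsto_abs_atTop_atTop)).mul_const D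
  rw [zero_mul] at h1
  filter_upwards [h1.norm.eventually_lt_const (by simp : ‖(0 : Matrix ι ι ℝ)‖ < 1)] with r hr
  refine tendsto_pow_mulVec_of_norm_lt_one ?_
  rwa [Matrix.nonsing_inv_eq_ringInverse, ← Algebra.algebraMap_eq_smul_one]

/-- The difference quotients `(e^{hA} - 1) / h` tend to `A` as `h → 0⁺`. -/
lemma tendsto_exp_slope (A : Matrix ι ι ℝ) :
    Tendsto (fun h : ℝ => h⁻¹ • (NormedSpace.exp (h • A) - 1)) (𝓝[>] 0) (𝓝 A) := by
  have h1 := hasDerivAt_iff_tendsto_slope_zero.1 (hasDerivAt_exp_smul_const (𝕂 := ℝ) A (0 : ℝ))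
  simp only [zero_add, zero_smul, NormedSpace.exp_zero, one_mul] at h1
  exact h1.mono_left (nhdsWithin_mono _ fun _ h => ne_of_gt h)

/-- For r > ‖A‖ and small h > 0, the slope estimate gives ‖e^{hA}‖ < 1 + rh, so the scaled
exponential is a strict contraction. -/
lemma eventually_tendsto_exp_pow (A : Matrix ι ι ℝ) :
    ∀ᶠ r : ℝ in atTop, ∀ᶠ h : ℝ in 𝓝[>] 0, 0 < 1 + r * h ∧ ∀ x, Tendsto
      (fun k : ℕ => (((1 + r * h)⁻¹ • NormedSpace.exp (h • A)) ^ k) *ᵥ x) atTop (𝓝 0) := by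
  filter_upwards [eventually_gt_atTop ‖A‖] with r hr
  filter_upwards [(tendsto_exp_slope A).norm.eventually_lt_const hr, self_mem_nhdsWithin]
    with h hh h0
  have h0 : 0 < h := h0
  have hr0 : 0 < r := (norm_nonneg A).trans_lt hr
  have hpos : 0 < 1 + r * h := by positivity
  refine ⟨hpos, tendsto_pow_mulVec_of_norm_lt_one ?_⟩
  have e : NormedSpace.exp (h • A) = 1 + h • (h⁻¹ • (NormedSpace.exp (h • A) - 1)) := by
    rw [smul_smul, mul_inv_cancel₀ h0.ne', one_smul]; abel
  have hb : ‖NormedSpace.exp (h • A)‖ < 1 + r * h := by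
    calc ‖NormedSpace.exp (h • A)‖
        ≤ ‖(1 : Matrix ι ι ℝ)‖ + ‖h • (h⁻¹ • (NormedSpace.exp (h • A) - 1))‖ := by
          conv_lhs => rw [e]
          exact norm_add_le _ _
      _ < 1 + r * h := by
          rw [norm_smul, Real.norm_of_nonneg h0.le, mul_comm r]
          exact add_lt_add_of_le_of_lt norm_one_matrix_le (mul_lt_mul_of_pos_left hh h0)
  rw [norm_smul, norm_inv, Real.norm_of_nonneg hpos.le, inv_mul_lt_iff₀ hpos]
  linarith

end Norms

/-! ### Inverse-positive matrices and Hurwitz criteria -/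

section InversePositive

variable {n : ℕ} {P : ProperCone ℝ (Fin n → ℝ)}

/-- A square matrix `X` is inverse-positive if `X x ∈ P` implies `x ∈ P`. For a salient cone this
means that `X` is invertible and `X⁻¹` is monotone. -/
def IsInversePositive (P : ProperCone ℝ (Fin n → ℝ)) (X : Matrix (Fin n) (Fin n) ℝ) : Prop :=
  ∀ x, X *ᵥ x ∈ P → x ∈ P

lemma IsInversePositive.mul {X Y : Matrix (Fin n) (Fin n) ℝ} (hX : IsInversePositive P X)
    (hY : IsInversePositive P Y) : IsInversePositive P (X * Y) := fun x hx =>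
  hY x (hX _ (by rwa [Matrix.mulVec_mulVec]))

lemma IsInversePositive.isUnit_det (hP : IsOrderCone P) {X : Matrix (Fin n) (Fin n) ℝ}
    (hX : IsInversePositive P X) : IsUnit X.det := by
  rw [isUnit_iff_ne_zero]
  intro h
  obtain ⟨x, hx, h0⟩ := Matrix.exists_mulVec_eq_zero_iff.2 h
  refine hx (hP.salient x (hX x ?_) (hX (-x) ?_))
  · rw [h0]; exact P.zero_mem
  · rw [Matrix.mulVec_neg, h0, neg_zero]; exact P.zero_mem

lemma IsInversePositive.inv_mulVec_mem {X : Matrix (Fin n) (Fin n) ℝ}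
    (hX : IsInversePositive P X) (hu : IsUnit X.det) {x : Fin n → ℝ} (hx : x ∈ P) :
    X⁻¹ *ᵥ x ∈ P :=
  hX _ (by rwa [Matrix.mulVec_mulVec, Matrix.mul_nonsing_inv _ hu, Matrix.one_mulVec])

lemma IsInversePositive.mem_interior {X : Matrix (Fin n) (Fin n) ℝ} (hX : IsInversePositive P X)
    {x : Fin n → ℝ} (hx : X *ᵥ x ∈ interior (P : Set (Fin n → ℝ))) :
    x ∈ interior (P : Set (Fin n → ℝ)) :=
  _root_.mem_interior.2 ⟨(fun z => X *ᵥ z) ⁻¹' interior (P : Set (Fin n → ℝ)),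
    fun z hz => hX z (interior_subset hz), isOpen_interior.preimage (by fun_prop), hx⟩

/-- Neumann series: x - Sᵏx is the sum of Sʲ(x - Sx) over j < k, hence in the cone, and it tends to
x. -/
lemma isInversePositive_one_sub {S : Matrix (Fin n) (Fin n) ℝ} (hS : ∀ x ∈ P, S *ᵥ x ∈ P)
    (h0 : ∀ x, Tendsto (fun k : ℕ => (S ^ k) *ᵥ x) atTop (𝓝 0)) :
    IsInversePositive P (1 - S) := by
  intro x hx
  rw [Matrix.sub_mulVec, Matrix.one_mulVec] at hx
  have hk : ∀ k : ℕ, x - (S ^ k) *ᵥ x ∈ P := by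
    intro k
    induction k with
    | zero => simp
    | succ k ih =>
      have := P.add_mem hx (hS _ ih)
      rwa [Matrix.mulVec_sub, sub_add_sub_cancel, Matrix.mulVec_mulVec, ← pow_succ'] at this
  have ht : Tendsto (fun k : ℕ => x - (S ^ k) *ᵥ x) atTop (𝓝 x) := by
    simpa using (tendsto_const_nhds (x := x)).sub (h0 x)
  exact P.isClosed.mem_of_tendsto ht (Eventually.of_forall hk)

/-- If Yx is interior, then so is Xᵢx for some inverse-positive Xᵢ. A general x is the limit of x +
εY⁻¹e with e interior, whose images under Y are interior. -/
lemma isInversePositive_of_tendsto {κ : Type*} {l : Filter κ} [l.NeBot] (hP : IsOrderCone P)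
    {X : κ → Matrix (Fin n) (Fin n) ℝ} {Y : Matrix (Fin n) (Fin n) ℝ} (h : Tendsto X l (𝓝 Y))
    (hX : ∀ᶠ i in l, IsInversePositive P (X i)) (hY : IsUnit Y.det) : IsInversePositive P Y := by
  have hint : ∀ x, Y *ᵥ x ∈ interior (P : Set (Fin n → ℝ)) → x ∈ P := by
    intro x hx
    obtain ⟨i, hi, hi'⟩ := (hX.and
      ((tendsto_mulVec h x).eventually (isOpen_interior.mem_nhds hx))).exists
    exact hi x (interior_subset hi')
  intro x hx
  obtain ⟨e, he⟩ := hP.solid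
  have hc : Tendsto (fun ε : ℝ => x + ε • (Y⁻¹ *ᵥ e)) (𝓝[>] 0) (𝓝 x) := by
    have : Continuous (fun ε : ℝ => x + ε • (Y⁻¹ *ᵥ e)) := by fun_prop
    simpa using (this.tendsto 0).mono_left nhdsWithin_le_nhds
  refine P.isClosed.mem_of_tendsto hc ?_
  filter_upwards [self_mem_nhdsWithin] with ε hε
  refine hint _ ?_
  rw [Matrix.mulVec_add, Matrix.mulVec_smul, Matrix.mulVec_mulVec, Matrix.mul_nonsing_inv _ hY,
    Matrix.one_mulVec, add_comm]
  exact interior_add_mem (smul_mem_interior hε he) hx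

/-- The matrix r - (e^{hA} - 1)/h is a positive multiple of 1 - (1 + rh)⁻¹e^{hA}, to which the
Neumann argument applies; then h → 0⁺. -/
lemma IsQuasiMonotone.eventually_isInversePositive (hP : IsOrderCone P)
    {A : Matrix (Fin n) (Fin n) ℝ} (hA : IsQuasiMonotone P A) :
    ∀ᶠ r : ℝ in atTop, IsInversePositive P (r • (1 : Matrix (Fin n) (Fin n) ℝ) - A) := by
  filter_upwards [eventually_isUnit_resolvent A, eventually_tendsto_exp_pow A] with r hr hexp
  refine isInversePositive_of_tendsto hP ((tendsto_const_nhds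
    (x := r • (1 : Matrix (Fin n) (Fin n) ℝ))).sub (tendsto_exp_slope A)) ?_ hr
  filter_upwards [hexp, self_mem_nhdsWithin] with h hh h0
  have h0 : 0 < h := h0
  have hS := isInversePositive_one_sub (P := P) (fun x hx => by
    rw [Matrix.smul_mulVec]
    exact P.smul_mem (isMonotone_iff.1 (hA h h0) x hx) (inv_nonneg.2 hh.1.le)) hh.2
  intro x hx
  refine hS x ?_
  have e : (1 - (1 + r * h)⁻¹ • NormedSpace.exp (h • A) : Matrix (Fin n) (Fin n) ℝ) =
      ((1 + r * h)⁻¹ * h) • (r • 1 - h⁻¹ • (NormedSpace.exp (h • A) - 1)) := by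
    have h1 := hh.1.ne'
    have h2 : ((1 + r * h)⁻¹ * h) * r + (1 + r * h)⁻¹ = 1 := by field_simp; ring
    rw [smul_sub, smul_smul, smul_smul, mul_assoc (1 + r * h)⁻¹ h h⁻¹, mul_inv_cancel₀ h0.ne',
      mul_one, smul_sub, sub_sub_eq_add_sub, ← add_smul, h2, one_smul]
  rw [e, Matrix.smul_mulVec]
  exact P.smul_mem hx (mul_nonneg (inv_nonneg.2 hh.1.le) h0.le)

/-- If the resolvent of a Hurwitz matrix is positive near `+∞`, it is positive at `0`. -/
lemma IsHurwitz.isInversePositive_neg {M : Matrix (Fin n) (Fin n) ℝ} (hM : IsHurwitz M)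
    (hr : ∀ᶠ r : ℝ in atTop, IsInversePositive P (r • (1 : Matrix (Fin n) (Fin n) ℝ) - M)) :
    IsInversePositive P (-M) := by
  obtain ⟨r, ⟨hX, hu⟩, hr⟩ :=
    ((hr.and (eventually_isUnit_resolvent M)).and (eventually_gt_atTop 0)).exists
  set X := r • (1 : Matrix (Fin n) (Fin n) ℝ) - M with hXdef
  have hXR : X * (r • X⁻¹) = r • 1 := by rw [Matrix.mul_smul, Matrix.mul_nonsing_inv _ hu]
  -- An eigenvalue λ of M corresponds to the eigenvalue ν = r/(r - λ) of rX⁻¹, and Re λ < 0 gives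
  -- |ν| < 1.
  have e : -M = X * (1 - r • X⁻¹) := by
    rw [mul_sub, hXR, mul_one, hXdef]; abel
  rw [e]
  refine hX.mul (isInversePositive_one_sub (fun x hx => ?_)
    (tendsto_pow_mulVec_of_specRadius_lt_one (specRadius_lt_one_iff.2 fun ν hν => ?_)))
  · rw [Matrix.smul_mulVec]
    exact P.smul_mem (hX.inv_mulVec_mem hu hx) hr.le
  · obtain ⟨z, hz, h⟩ := mem_eigenvalues_iff.1 hν
    rcases eq_or_ne ν 0 with rfl | hν0
    · simp
    have hC : X.map Complex.ofReal * (r • X⁻¹).map Complex.ofReal = (r : ℂ) • 1 := by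
      have := congrArg (Complex.ofRealHom.mapMatrix (m := Fin n)) hXR
      rw [map_mul] at this
      refine this.trans ?_
      ext i j
      by_cases hij : i = j <;> simp [hij]
    have hXC : X.map Complex.ofReal = (r : ℂ) • 1 - M.map Complex.ofReal := by
      ext i j
      simp [hXdef, Matrix.one_apply, apply_ite]
    have h1 : (r : ℂ) • z = ν • ((r : ℂ) • z - M.map Complex.ofReal *ᵥ z) := by
      have := congrArg (X.map Complex.ofReal *ᵥ ·) h
      simp only [Matrix.mulVec_mulVec, hC, Matrix.mulVec_smul] at this
      rwa [Matrix.smul_mulVec, Matrix.one_mulVec, hXC, Matrix.sub_mulVec, Matrix.smul_mulVec,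
        Matrix.one_mulVec] at this
    have h2 : M.map Complex.ofReal *ᵥ z = ((r : ℂ) - ν⁻¹ * r) • z := by
      have := congrArg (ν⁻¹ • ·) h1
      simp only [smul_smul, inv_mul_cancel₀ hν0, one_smul] at this
      rw [sub_smul, this]; abel
    have h3 := hM _ (mem_eigenvalues_iff.2 ⟨z, hz, h2⟩)
    rw [Complex.sub_re, Complex.re_mul_ofReal, Complex.ofReal_re] at h3
    have h4 : 1 < ν⁻¹.re := by nlinarith
    have h5 := h4.trans_le (Complex.re_le_norm _)
    rw [norm_inv] at h5
    exact (one_lt_inv₀ (norm_pos_iff.2 hν0)).1 h5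

lemma eventually_isInversePositive_sub (hP : IsOrderCone P) {A D : Matrix (Fin n) (Fin n) ℝ}
    (hA : ∀ᶠ r : ℝ in atTop, IsInversePositive P (r • (1 : Matrix (Fin n) (Fin n) ℝ) - A))
    (hD : IsMonotone P P D) :
    ∀ᶠ r : ℝ in atTop, IsInversePositive P (r • (1 : Matrix (Fin n) (Fin n) ℝ) - (A + D)) := by
  filter_upwards [hA, eventually_tendsto_resolvent_mul_pow A D] with r hr hS
  have hu := hr.isUnit_det hP
  have e : r • (1 : Matrix (Fin n) (Fin n) ℝ) - (A + D) =
      (r • 1 - A) * (1 - (r • 1 - A)⁻¹ * D) := by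
    rw [mul_sub, mul_one, ← mul_assoc, Matrix.mul_nonsing_inv _ hu, one_mul, sub_sub]
  rw [e]
  refine hr.mul (isInversePositive_one_sub (fun x hx => ?_) hS)
  rw [← Matrix.mulVec_mulVec]
  exact hr.inv_mulVec_mem hu (isMonotone_iff.1 hD x hx)

/-- As r → ∞, |r - μ| = r - Re μ + o(1); squaring the inequality makes this explicit. -/
lemma re_le_neg_of_eventually {μ : ℂ} {ε : ℝ}
    (h : ∀ᶠ r : ℝ in atTop, r + ε ≤ ‖(r : ℂ) - μ‖) : μ.re ≤ -ε := by
  by_contra! hlt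
  have hpos : 0 < ε + μ.re := by linarith
  obtain ⟨r, ⟨h1, h2⟩, h3⟩ := ((h.and (eventually_gt_atTop
    ((μ.re ^ 2 + μ.im ^ 2) / (2 * (ε + μ.re))))).and (eventually_ge_atTop (-ε))).exists
  rw [div_lt_iff₀ (by positivity)] at h2
  have h4 := pow_le_pow_left₀ (by linarith : 0 ≤ r + ε) h1 2
  rw [← Complex.normSq_eq_norm_sq, Complex.normSq_apply] at h4
  simp only [Complex.sub_re, Complex.ofReal_re, Complex.sub_im, Complex.ofReal_im] at h4
  nlinarith [sq_nonneg ε]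

lemma inv_sub_mem_eigenvalues {N : Matrix (Fin n) (Fin n) ℝ} {r : ℝ}
    (hu : IsUnit (r • (1 : Matrix (Fin n) (Fin n) ℝ) - N).det) {μ : ℂ} (hμ : μ ∈ eigenvalues N) :
    (r : ℂ) - μ ≠ 0 ∧
      ((r : ℂ) - μ)⁻¹ ∈ eigenvalues (r • (1 : Matrix (Fin n) (Fin n) ℝ) - N)⁻¹ := by
  obtain ⟨z, hz, h⟩ := mem_eigenvalues_iff.1 hμ
  set X := r • (1 : Matrix (Fin n) (Fin n) ℝ) - N with hX
  have hC : X⁻¹.map Complex.ofReal * X.map Complex.ofReal = 1 := by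
    have := congrArg (Complex.ofRealHom.mapMatrix (m := Fin n)) (Matrix.nonsing_inv_mul X hu)
    rwa [map_mul, map_one] at this
  have hXz : X.map Complex.ofReal *ᵥ z = ((r : ℂ) - μ) • z := by
    have hXC : X.map Complex.ofReal = (r : ℂ) • 1 - N.map Complex.ofReal := by
      ext i j
      simp [hX, Matrix.one_apply, apply_ite]
    rw [hXC, Matrix.sub_mulVec, Matrix.smul_mulVec, Matrix.one_mulVec, h, sub_smul]
  have h1 : z = ((r : ℂ) - μ) • (X⁻¹.map Complex.ofReal *ᵥ z) := by
    rw [← Matrix.mulVec_smul, ← hXz, Matrix.mulVec_mulVec, hC, Matrix.one_mulVec]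
  have h0 : (r : ℂ) - μ ≠ 0 := fun h0 => hz (by rw [h1, h0, zero_smul])
  refine ⟨h0, mem_eigenvalues_iff.2 ⟨z, hz, ?_⟩⟩
  conv_rhs => rw [h1]
  rw [smul_smul, inv_mul_cancel₀ h0, one_smul]

/-- If `A` has a positive resolvent near `+∞`, `D` is monotone, and `A + D` maps an interior point
of the cone to the negative of an interior point, then `A + D` and `A - D` are Hurwitz. -/
lemma isHurwitz_of_interior (hP : IsOrderCone P) {A D : Matrix (Fin n) (Fin n) ℝ}
    (hA : ∀ᶠ r : ℝ in atTop, IsInversePositive P (r • (1 : Matrix (Fin n) (Fin n) ℝ) - A))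
    (hD : IsMonotone P P D) {v : Fin n → ℝ} (hv : v ∈ interior (P : Set (Fin n → ℝ)))
    (hp : -((A + D) *ᵥ v) ∈ interior (P : Set (Fin n → ℝ)))
    {N : Matrix (Fin n) (Fin n) ℝ} (hN : N = A + D ∨ N = A - D) : IsHurwitz N := by
  intro μ hμ
  obtain ⟨ε, hε, hε0⟩ := ((eventually_sub_smul_mem hp v).and self_mem_nhdsWithin).exists
  have hε0 : 0 < ε := hε0
  refine lt_of_le_of_lt (re_le_neg_of_eventually (ε := ε) ?_) (neg_lt_zero.2 hε0)
  -- It suffices that the eigenvalue (r - μ)⁻¹ of (r - N)⁻¹ has modulus at most (r + ε)⁻¹, which the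
  -- order unit v will show.
  filter_upwards [hA, eventually_tendsto_resolvent_mul_pow A D, eventually_isUnit_resolvent N,
    eventually_gt_atTop 0] with r hr hS hNu hr0
  have hu := hr.isUnit_det hP
  obtain ⟨hne, hmem⟩ := inv_sub_mem_eigenvalues hNu hμ
  set X := r • (1 : Matrix (Fin n) (Fin n) ℝ) - A with hX
  set S := X⁻¹ * D with hSdef
  have hSP : ∀ x ∈ P, S *ᵥ x ∈ P := fun x hx => by
    rw [hSdef, ← Matrix.mulVec_mulVec]
    exact hr.inv_mulVec_mem hu (isMonotone_iff.1 hD x hx)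
  have hS1 : IsInversePositive P (1 - S) := isInversePositive_one_sub hSP hS
  have hS2 : IsInversePositive P (1 - S ^ 2) := by
    refine isInversePositive_one_sub (fun x hx => ?_) fun x => ?_
    · rw [pow_two, ← Matrix.mulVec_mulVec]; exact hSP _ (hSP _ hx)
    · simp only [← pow_mul]
      exact (hS x).comp (tendsto_id.const_mul_atTop' two_pos)
  have hc : 0 < (r + ε)⁻¹ := inv_pos.2 (by linarith)
  -- With u = (r + ε)⁻¹v, this is X⁻¹v ≤ (1 - S)u, a rewriting of εv ≤ -(A + D)v.
  have hg : (r + ε)⁻¹ • v - S *ᵥ ((r + ε)⁻¹ • v) - X⁻¹ *ᵥ v ∈ P := by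
    have h1 := hr.inv_mulVec_mem hu (P.smul_mem hε hc.le)
    have h2 : (r + ε)⁻¹ • (-((A + D) *ᵥ v) - ε • v) =
        X *ᵥ ((r + ε)⁻¹ • v) - D *ᵥ ((r + ε)⁻¹ • v) - v := by
      have h3 : (r + ε)⁻¹ • (r + ε) • v = v := by
        rw [smul_smul, inv_mul_cancel₀ (by linarith), one_smul]
      rw [hX, Matrix.mulVec_smul, Matrix.mulVec_smul, Matrix.sub_mulVec, Matrix.smul_mulVec,
        Matrix.one_mulVec, Matrix.add_mulVec]
      linear_combination (norm := module) -h3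
    rw [h2, Matrix.mulVec_sub, Matrix.mulVec_sub, Matrix.mulVec_mulVec, Matrix.mulVec_mulVec,
      Matrix.nonsing_inv_mul _ hu, Matrix.one_mulVec] at h1
    exact h1
  have hb := norm_eigenvalue_le_of_order_unit hP hv hc.le (fun x h1 h2 => ?_) hmem
  · rwa [norm_inv, inv_le_inv₀ (norm_pos_iff.2 hne) (by linarith)] at hb
  set u := (r + ε)⁻¹ • v
  set y := (r • (1 : Matrix (Fin n) (Fin n) ℝ) - N)⁻¹ *ᵥ x with hy
  have hyx : (r • (1 : Matrix (Fin n) (Fin n) ℝ) - N) *ᵥ y = x := by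
    rw [hy, Matrix.mulVec_mulVec, Matrix.mul_nonsing_inv _ hNu, Matrix.one_mulVec]
  have ha : _ ∈ P := P.add_mem hg (hr.inv_mulVec_mem hu h1)
  have hb : _ ∈ P := P.add_mem hg (hr.inv_mulVec_mem hu h2)
  rw [Matrix.mulVec_add] at ha
  rw [Matrix.mulVec_sub] at hb
  rcases hN with rfl | rfl
  · have hxy : X⁻¹ *ᵥ x = y - S *ᵥ y := by
      rw [← hyx, ← sub_sub, ← hX, Matrix.sub_mulVec, Matrix.mulVec_sub, Matrix.mulVec_mulVec,
        Matrix.nonsing_inv_mul _ hu, Matrix.one_mulVec, Matrix.mulVec_mulVec]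
    constructor
    · refine hS1 _ ?_
      convert ha using 1
      rw [hxy, Matrix.sub_mulVec, Matrix.one_mulVec, Matrix.mulVec_add]
      abel
    · refine hS1 _ ?_
      convert hb using 1
      rw [hxy, Matrix.sub_mulVec, Matrix.one_mulVec, Matrix.mulVec_sub]
      abel
  · have hxy : X⁻¹ *ᵥ x = y + S *ᵥ y := by
      rw [← hyx, sub_sub_eq_add_sub, add_sub_right_comm, ← hX, Matrix.add_mulVec,
        Matrix.mulVec_add, Matrix.mulVec_mulVec,
        Matrix.nonsing_inv_mul _ hu, Matrix.one_mulVec, Matrix.mulVec_mulVec]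
    constructor
    -- Here (1 + S)y = X⁻¹x and 1 + S need not be inverse-positive. Adding S applied to (1 - S)u -
    -- (1 + S)y to (1 - S)u + (1 + S)y yields (1 - S²)(u + y).
    · refine hS2 _ ?_
      have hab : _ ∈ P := P.add_mem ha (hSP _ hb)
      convert hab using 1
      rw [hxy, Matrix.sub_mulVec, Matrix.one_mulVec, pow_two, ← Matrix.mulVec_mulVec]
      simp only [Matrix.mulVec_add, Matrix.mulVec_sub]
      abel
    · refine hS2 _ ?_
      have hab : _ ∈ P := P.add_mem hb (hSP _ ha)
      convert hab using 1
      rw [hxy, Matrix.sub_mulVec, Matrix.one_mulVec, pow_two, ← Matrix.mulVec_mulVec]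
      simp only [Matrix.mulVec_add, Matrix.mulVec_sub]
      abel

end InversePositive

/-! ### Small gain: transfer between inputs and states -/

section SmallGain

variable {n m : ℕ} {P : ProperCone ℝ (Fin n → ℝ)} {Q : ProperCone ℝ (Fin m → ℝ)}
  {A : Matrix (Fin n) (Fin n) ℝ} {B : Matrix (Fin n) (Fin m) ℝ} {C : Matrix (Fin m) (Fin n) ℝ}

lemma gain_mulVec (hu : IsUnit (-A).det) (w : Fin m → ℝ) :
    gain A B C *ᵥ w = C *ᵥ ((-A)⁻¹ *ᵥ (B *ᵥ w)) := by
  have h : A⁻¹ = -(-A)⁻¹ := Matrix.inv_eq_right_inv (by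
    rw [Matrix.mul_neg, ← Matrix.neg_mul, Matrix.mul_nonsing_inv _ hu])
  rw [gain, h, Matrix.mul_neg, Matrix.neg_mul, neg_neg, Matrix.mulVec_mulVec,
    Matrix.mulVec_mulVec]

lemma gain_mem (hA : IsInversePositive P (-A)) (hu : IsUnit (-A).det) (hB : IsMonotone Q P B)
    (hC : IsMonotone P Q C) {w : Fin m → ℝ} (hw : w ∈ Q) : gain A B C *ᵥ w ∈ Q := by
  rw [gain_mulVec hu]
  exact isMonotone_iff.1 hC _ (hA.inv_mulVec_mem hu (isMonotone_iff.1 hB _ hw))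

/-- Take v = (-A)⁻¹(Bw + δe) with e interior: then -(A + BC)v = δe + B(w - Kw - δC(-A)⁻¹e). The term
δe is needed because B may send interior points to the boundary. -/
lemma exists_interior_state (hP : IsOrderCone P) (hA : IsInversePositive P (-A))
    (hB : IsMonotone Q P B) {w : Fin m → ℝ} (hw : w ∈ interior (Q : Set (Fin m → ℝ)))
    (hKw : w - gain A B C *ᵥ w ∈ interior (Q : Set (Fin m → ℝ))) :
    ∃ v ∈ interior (P : Set (Fin n → ℝ)),
      -((A + B * C) *ᵥ v) ∈ interior (P : Set (Fin n → ℝ)) := by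
  have hu := hA.isUnit_det hP
  obtain ⟨e, he⟩ := hP.solid
  obtain ⟨δ, hδ, hδ0⟩ := ((eventually_sub_smul_mem hKw (C *ᵥ ((-A)⁻¹ *ᵥ e))).and
    self_mem_nhdsWithin).exists
  have hδ0 : 0 < δ := hδ0
  set v := (-A)⁻¹ *ᵥ (B *ᵥ w + δ • e) with hv
  have hAv : (-A) *ᵥ v = B *ᵥ w + δ • e := by
    rw [hv, Matrix.mulVec_mulVec, Matrix.mul_nonsing_inv _ hu, Matrix.one_mulVec]
  refine ⟨v, hA.mem_interior ?_, ?_⟩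
  · rw [hAv, add_comm]
    exact interior_add_mem (smul_mem_interior hδ0 he) (isMonotone_iff.1 hB _ (interior_subset hw))
  · have h1 := interior_add_mem (smul_mem_interior hδ0 he) (isMonotone_iff.1 hB _ hδ)
    convert h1 using 1
    have hCv : C *ᵥ v = gain A B C *ᵥ w + δ • (C *ᵥ ((-A)⁻¹ *ᵥ e)) := by
      rw [hv, gain_mulVec hu]
      simp only [Matrix.mulVec_add, Matrix.mulVec_smul]
    rw [Matrix.neg_mulVec] at hAv
    rw [Matrix.add_mulVec, neg_add, hAv, ← Matrix.mulVec_mulVec, hCv]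
    simp only [Matrix.mulVec_add, Matrix.mulVec_sub]
    abel

/-- Take w = δf + Cv with f interior: then w - Kw = δf + C(-A)⁻¹(-(A + BC)v - δBf). -/
lemma exists_interior_input (hP : IsOrderCone P) (hQ : IsOrderCone Q)
    (hA : IsInversePositive P (-A)) (hC : IsMonotone P Q C)
    {v : Fin n → ℝ} (hv : v ∈ interior (P : Set (Fin n → ℝ)))
    (hMv : -((A + B * C) *ᵥ v) ∈ interior (P : Set (Fin n → ℝ))) :
    ∃ w ∈ interior (Q : Set (Fin m → ℝ)),
      w - gain A B C *ᵥ w ∈ interior (Q : Set (Fin m → ℝ)) := by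
  have hu := hA.isUnit_det hP
  obtain ⟨f, hf⟩ := hQ.solid
  obtain ⟨δ, hδ, hδ0⟩ := ((eventually_sub_smul_mem hMv (B *ᵥ f)).and self_mem_nhdsWithin).exists
  have hδ0 : 0 < δ := hδ0
  refine ⟨δ • f + C *ᵥ v, interior_add_mem (smul_mem_interior hδ0 hf)
    (isMonotone_iff.1 hC _ (interior_subset hv)), ?_⟩
  convert interior_add_mem (smul_mem_interior hδ0 hf)
    (isMonotone_iff.1 hC _ (hA.inv_mulVec_mem hu hδ)) using 1
  have h1 : (-A)⁻¹ *ᵥ (-((A + B * C) *ᵥ v)) = v - (-A)⁻¹ *ᵥ (B *ᵥ (C *ᵥ v)) := by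
    rw [Matrix.add_mulVec, neg_add, ← Matrix.neg_mulVec, Matrix.mulVec_add, Matrix.mulVec_mulVec,
      Matrix.nonsing_inv_mul _ hu, Matrix.one_mulVec, Matrix.mulVec_neg, Matrix.mulVec_mulVec,
      sub_eq_add_neg, Matrix.mulVec_mulVec, Matrix.mulVec_mulVec, Matrix.mul_assoc]
  rw [Matrix.mulVec_sub, h1, gain_mulVec hu]
  simp only [Matrix.mulVec_add, Matrix.mulVec_sub, Matrix.mulVec_smul]
  abel

/-- Since Kw ≤ (1 - ε)w for some 0 < ε ≤ 1, K maps [-w, w] into (1 - ε)[-w, w]. -/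
lemma specRadius_lt_one_of_interior (hQ : IsOrderCone Q) {K : Matrix (Fin m) (Fin m) ℝ}
    (hK : ∀ w ∈ Q, K *ᵥ w ∈ Q) {w : Fin m → ℝ} (hw : w ∈ interior (Q : Set (Fin m → ℝ)))
    (hKw : w - K *ᵥ w ∈ interior (Q : Set (Fin m → ℝ))) : specRadius K < 1 := by
  obtain ⟨ε, ⟨hε, hε0⟩, hε1⟩ := ((eventually_sub_smul_mem hKw w).and
    self_mem_nhdsWithin).and (nhdsWithin_le_nhds (Iic_mem_nhds one_pos)) |>.exists
  have hε0 : 0 < ε := hε0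
  have hε1 : ε ≤ 1 := hε1
  refine specRadius_lt_one_iff.2 fun μ hμ => lt_of_le_of_lt
    (norm_eigenvalue_le_of_order_unit (c := 1 - ε) hQ hw (by linarith) (fun x h1 h2 => ?_) hμ)
    (by linarith)
  have ha : _ ∈ Q := Q.add_mem hε (hK _ h1)
  have hb : _ ∈ Q := Q.add_mem hε (hK _ h2)
  rw [Matrix.mulVec_add] at ha
  rw [Matrix.mulVec_sub] at hb
  constructor
  · convert ha using 1; module
  · convert hb using 1; module

lemma exists_interior_of_tendsto (hQ : IsOrderCone Q) {K : Matrix (Fin m) (Fin m) ℝ}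
    (hK : ∀ w ∈ Q, K *ᵥ w ∈ Q) (h0 : ∀ x, Tendsto (fun k : ℕ => (K ^ k) *ᵥ x) atTop (𝓝 0)) :
    ∃ w ∈ interior (Q : Set (Fin m → ℝ)), w - K *ᵥ w ∈ interior (Q : Set (Fin m → ℝ)) := by
  have h1 := isInversePositive_one_sub hK h0
  obtain ⟨e, he⟩ := hQ.solid
  have hw : (1 - K) *ᵥ ((1 - K)⁻¹ *ᵥ e) = e := by
    rw [Matrix.mulVec_mulVec, Matrix.mul_nonsing_inv _ (h1.isUnit_det hQ), Matrix.one_mulVec]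
  refine ⟨_, h1.mem_interior (hw.symm ▸ he), ?_⟩
  rw [Matrix.sub_mulVec, Matrix.one_mulVec] at hw
  rwa [hw]

lemma tendsto_neg_pow_mulVec {K : Matrix (Fin m) (Fin m) ℝ} {x : Fin m → ℝ}
    (h : Tendsto (fun k : ℕ => (K ^ k) *ᵥ x) atTop (𝓝 0)) :
    Tendsto (fun k : ℕ => ((-K) ^ k) *ᵥ x) atTop (𝓝 0) := by
  rw [tendsto_zero_iff_norm_tendsto_zero] at h ⊢
  refine h.congr fun k => ?_
  rcases k.even_or_odd with hk | hk
  · rw [hk.neg_pow]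
  · rw [hk.neg_pow, Matrix.neg_mulVec, norm_neg]

lemma characteristic_iterate (k : ℕ) (u : Fin m → ℝ) :
    (characteristic A B C)^[k] u = ((-gain A B C) ^ k) *ᵥ u := by
  induction k with
  | zero => simp
  | succ k ih =>
    rw [Function.iterate_succ_apply', ih, pow_succ', ← Matrix.mulVec_mulVec]
    generalize (-gain A B C) ^ k *ᵥ u = w
    rw [characteristic, gain, neg_neg, Matrix.mulVec_neg, neg_neg, Matrix.mulVec_mulVec,
      Matrix.mulVec_mulVec]

/-- The swap symmetry of the block matrix sends an eigenvector (x, y) to x + y for A - D and to x -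
y for A + D; the two cannot both vanish. -/
lemma eigenvalues_fromBlocks {A D : Matrix (Fin n) (Fin n) ℝ} :
    eigenvalues (fromBlocks A (-D) (-D) A) = eigenvalues (A - D) ∪ eigenvalues (A + D) := by
  ext μ
  simp only [Set.mem_union, mem_eigenvalues_iff]
  have hs : (A - D).map Complex.ofReal = A.map Complex.ofReal - D.map Complex.ofReal := by
    ext; simp
  have ha : (A + D).map Complex.ofReal = A.map Complex.ofReal + D.map Complex.ofReal := by
    ext; simp
  have hn : (-D).map Complex.ofReal = -D.map Complex.ofReal := by
    ext; simp
  rw [hs, ha, Matrix.fromBlocks_map, hn]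
  generalize A.map Complex.ofReal = A'
  generalize D.map Complex.ofReal = D'
  constructor
  · rintro ⟨z, hz, h⟩
    obtain ⟨x, y, rfl⟩ : ∃ x y, z = Sum.elim x y := ⟨z ∘ Sum.inl, z ∘ Sum.inr, by simp⟩
    rw [Matrix.fromBlocks_mulVec] at h
    have h1 : A' *ᵥ x - D' *ᵥ y = μ • x := by
      ext i; simpa [Matrix.neg_mulVec, sub_eq_add_neg] using congrFun h (Sum.inl i)
    have h2 : -(D' *ᵥ x) + A' *ᵥ y = μ • y := by
      ext i; simpa [Matrix.neg_mulVec] using congrFun h (Sum.inr i)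
    by_cases hxy : x + y = 0
    · refine Or.inr ⟨x - y, fun h0 => hz ?_, ?_⟩
      · have hx : x = 0 := by
          have : (2 : ℂ) • x = 0 := by linear_combination (norm := module) hxy + h0
          simpa using this
        have hy : y = 0 := by simpa [hx] using hxy
        ext i; rcases i with i | i <;> simp [hx, hy]
      · rw [Matrix.add_mulVec, Matrix.mulVec_sub, Matrix.mulVec_sub]
        linear_combination (norm := module) h1 - h2
    · refine Or.inl ⟨x + y, hxy, ?_⟩
      rw [Matrix.sub_mulVec, Matrix.mulVec_add, Matrix.mulVec_add]
      linear_combination (norm := module) h1 + h2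
  · rintro (⟨z, hz, h⟩ | ⟨z, hz, h⟩)
    · refine ⟨Sum.elim z z, fun h0 => hz (funext fun i => congrFun h0 (Sum.inl i)), ?_⟩
      rw [Matrix.sub_mulVec] at h
      rw [Matrix.fromBlocks_mulVec]
      ext i
      rcases i with i | i
      · simpa [Matrix.neg_mulVec, sub_eq_add_neg] using congrFun h i
      · simpa [Matrix.neg_mulVec, sub_eq_add_neg, add_comm] using congrFun h i
    · refine ⟨Sum.elim z (-z), fun h0 => hz (funext fun i => congrFun h0 (Sum.inl i)), ?_⟩
      rw [Matrix.add_mulVec] at h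
      rw [Matrix.fromBlocks_mulVec]
      ext i
      rcases i with i | i
      · simpa [Matrix.neg_mulVec, Matrix.mulVec_neg] using congrFun h i
      · have := congrFun h i
        simp only [Pi.add_apply, Pi.smul_apply, smul_eq_mul] at this
        simp [Matrix.neg_mulVec, Matrix.mulVec_neg, ← this]

lemma closedLoop_eq : extF A B C + extG B * extH C = fromBlocks A (-(B * C)) (-(B * C)) A := by
  rw [extF, extG, extH, Matrix.fromRows_mul_fromCols, Matrix.fromBlocks_add]
  simp

lemma isHurwitz_closedLoop_iff : IsHurwitz (extF A B C + extG B * extH C) ↔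
    IsHurwitz (A - B * C) ∧ IsHurwitz (A + B * C) := by
  simp only [IsHurwitz, closedLoop_eq, eigenvalues_fromBlocks, Set.mem_union, or_imp,
    forall_and]

lemma eigenvalues_sq {M : Matrix (Fin m) (Fin m) ℝ} :
    eigenvalues (M ^ 2) = (· ^ 2) '' eigenvalues M := by
  have h : (M ^ 2).map Complex.ofReal = M.map Complex.ofReal ^ 2 :=
    map_pow (Complex.ofRealHom.mapMatrix (m := Fin m)) M 2
  rw [eigenvalues, h, spectrum.map_pow_of_pos _ two_pos]
  rfl

lemma norm_eigenvalues_sq_lt_one_iff {M : Matrix (Fin m) (Fin m) ℝ} :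
    (∀ μ ∈ eigenvalues (M ^ 2), ‖μ‖ < 1) ↔ ∀ μ ∈ eigenvalues M, ‖μ‖ < 1 := by
  rw [eigenvalues_sq, Set.forall_mem_image]
  simp only [norm_pow]
  exact forall₂_congr fun μ _ => pow_lt_one_iff_of_nonneg (norm_nonneg μ) two_ne_zero

end SmallGain

end ExtendedSystem

/-! ### The equivalences -/

theorem mainTheorem3 (n m : ℕ)
    (P : ProperCone ℝ (Fin n → ℝ)) (Q : ProperCone ℝ (Fin m → ℝ))
    (hP : ExtendedSystem.IsOrderCone P) (hQ : ExtendedSystem.IsOrderCone Q)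
    (A : Matrix (Fin n) (Fin n) ℝ) (B : Matrix (Fin n) (Fin m) ℝ)
    (C : Matrix (Fin m) (Fin n) ℝ)
    (hA : ExtendedSystem.IsQuasiMonotone P A) (hAH : ExtendedSystem.IsHurwitz A)
    (hB : ExtendedSystem.IsMonotone Q P B) (hC : ExtendedSystem.IsMonotone P Q C) :
    List.TFAE [
      ExtendedSystem.IsHurwitz
        (ExtendedSystem.extF A B C + ExtendedSystem.extG B * ExtendedSystem.extH C),
      ExtendedSystem.specRadius (ExtendedSystem.gain A B C) < 1,
      ∀ μ ∈ ExtendedSystem.eigenvalues (ExtendedSystem.gain A B C ^ 2), ‖μ‖ < 1,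
      ∃ w : Fin m → ℝ, ∀ u : Fin m → ℝ,
        Tendsto (fun k : ℕ => (ExtendedSystem.characteristic A B C)^[k] u) atTop (𝓝 w),
      ExtendedSystem.IsHurwitz (A - B * C) ∧ ExtendedSystem.IsHurwitz (A + B * C),
      ExtendedSystem.IsHurwitz (A + B * C)] := by
  open ExtendedSystem in
  have hRA := hA.eventually_isInversePositive hP
  have hAinv := hAH.isInversePositive_neg hRA
  have hD : IsMonotone P P (B * C) := fun x y h => by
    simpa only [Matrix.mulVec_mulVec] using hB _ _ (hC _ _ h)
  have hK : ∀ w ∈ Q, gain A B C *ᵥ w ∈ Q := fun w hw =>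
    gain_mem hAinv (hAinv.isUnit_det hP) hB hC hw
  tfae_have 1 ↔ 5 := isHurwitz_closedLoop_iff
  tfae_have 2 ↔ 3 := specRadius_lt_one_iff.trans norm_eigenvalues_sq_lt_one_iff.symm
  tfae_have 5 → 6 := And.right
  tfae_have 2 → 4 := fun h => ⟨0, fun u => by
    simpa only [characteristic_iterate] using
      tendsto_neg_pow_mulVec (tendsto_pow_mulVec_of_specRadius_lt_one h u)⟩
  tfae_have 4 → 5 := by
    rintro ⟨w, hw⟩
    simp only [characteristic_iterate] at hw
    -- The iteration is linear and fixes 0, so its global limit is 0.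
    have hw0 : w = 0 := tendsto_nhds_unique (hw 0) (by simp)
    obtain ⟨v, hv, hKv⟩ := exists_interior_of_tendsto hQ hK fun x => by
      have := tendsto_neg_pow_mulVec (hw0 ▸ hw x)
      rwa [neg_neg] at this
    obtain ⟨x, hx, hMx⟩ := exists_interior_state hP hAinv hB hv hKv
    exact ⟨isHurwitz_of_interior hP hRA hD hx hMx (Or.inr rfl),
      isHurwitz_of_interior hP hRA hD hx hMx (Or.inl rfl)⟩
  tfae_have 6 → 2 := by
    intro h
    have hM := h.isInversePositive_neg (eventually_isInversePositive_sub hP hRA hD)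
    obtain ⟨e, he⟩ := hP.solid
    -- The state certificate is the preimage under -(A + BC) of an interior point e.
    have hv : (-(A + B * C)) *ᵥ ((-(A + B * C))⁻¹ *ᵥ e) = e := by
      rw [Matrix.mulVec_mulVec, Matrix.mul_nonsing_inv _ (hM.isUnit_det hP), Matrix.one_mulVec]
    obtain ⟨w, hw, hKw⟩ := exists_interior_input hP hQ hAinv hC
      (hM.mem_interior (hv.symm ▸ he)) (by rw [← Matrix.neg_mulVec, hv]; exact he)
    exact specRadius_lt_one_of_interior hQ hK hw hKw
  tfae_finish
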